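/- For a metric space $X$, let $\mathrm{QI}(X)$ be the group, under composition, of quasi-isometries $X\to X$ modulo the relation of being at bounded distance, and let $\mathbb{R}_+=[0,\infty)$ with the usual metric. A group is locally indicable if each of its nontrivial finitely generated subgroups admits a surjective homomorphism onto $\mathbb{Z}$. **Lemma.** The group $\mathrm{QI}(\mathbb{R}_+)$ is not locally indicable. Moreover, let $\mathrm{PSL}_2(\mathbb{R})$ act on the hyperbolic plane $\mathbb{H}^2$ and on its boundary circle $S^1=\mathbb{RP}^1$. Let $\Delta<\mathrm{PSL}_2(\mathbb{R})$ be a $(2,3,7)$-triangle group, that is, the subgroup generated by the rotations by the angles $2\pi/2$, $2\pi/3$, $2\pi/7$ about the vertices of a hyperbolic triangle with interior angles $\pi/2$, $\pi/3$, $\pi/7$ at these vertices. Let $\Gamma<\mathrm{Homeo}(\mathbb{R})$ be its lift, that is, the group of all homeomorphisms of $\mathbb{R}$ which cover, under the universal covering $\mathbb{R}\to S^1$, the action of some element of $\Delta$ on $S^1$. Such groups $\Delta$ exist, and for each of them: 1. $\Gamma$ embeds into $\mathrm{QI}(\mathbb{R}_+)$, i.e. there is an injective homomorphism $\Gamma\to\mathrm{QI}(\mathbb{R}_+)$;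 2. $\Gamma$ is finitely generated; 3. every homomorphism from $\Gamma$ to $(\mathbb{R},+)$ is trivial. -/

import Mathlib

noncomputable section

/-- A map `f` between metric spaces is a quasi-isometry if, for some `K ≥ 1` and `C ≥ 0`,
`(1/K) d(x, y) - C ≤ d(f x, f y) ≤ K d(x, y) + C`, and every point is within `C` of the image. -/
def IsQuasiIsometry {X Y : Type*} [MetricSpace X] [MetricSpace Y] (f : X → Y) : Prop :=
  ∃ K C : ℝ, 1 ≤ K ∧ 0 ≤ C ∧
    (∀ x₁ x₂ : X, 1 / K * dist x₁ x₂ - C ≤ dist (f x₁) (f x₂) ∧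
      dist (f x₁) (f x₂) ≤ K * dist x₁ x₂ + C) ∧
    ∀ y : Y, ∃ x : X, dist (f x) y ≤ C

/-- Two maps are at bounded distance. -/
def BoundedDist {X Y : Type*} [MetricSpace Y] (f g : X → Y) : Prop :=
  ∃ M : ℝ, ∀ x : X, dist (f x) (g x) ≤ M

namespace IsQuasiIsometry

theorem refl (X : Type*) [MetricSpace X] : IsQuasiIsometry (fun x : X => x) :=
  ⟨1, 0, le_rfl, le_rfl, fun x₁ x₂ => by constructor <;> simp, fun y => ⟨y, by simp⟩⟩

theorem comp {X Y Z : Type*} [MetricSpace X] [MetricSpace Y] [MetricSpace Z]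
    {g : Y → Z} {f : X → Y} (hg : IsQuasiIsometry g) (hf : IsQuasiIsometry f) :
    IsQuasiIsometry (fun x => g (f x)) := by
  obtain ⟨K, C, hK, hC, h, hs⟩ := hg
  obtain ⟨L, D, hL, hD, h', hs'⟩ := hf
  have hK0 : 0 < K := by linarith
  have hL0 : 0 < L := by linarith
  have hKD : 0 ≤ K * D := by positivity
  refine ⟨K * L, K * D + 2 * C, by nlinarith, by positivity, fun x₁ x₂ => ⟨?_, ?_⟩, fun z => ?_⟩
  · have h1 := (h (f x₁) (f x₂)).1
    have h2 := mul_le_mul_of_nonneg_left (h' x₁ x₂).1 (by positivity : 0 ≤ 1 / K)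
    have h3 : 1 / K * D ≤ K * D := by
      apply mul_le_mul_of_nonneg_right _ hD
      rw [div_le_iff₀ hK0]; nlinarith
    have h4 : 1 / (K * L) * dist x₁ x₂ = 1 / K * (1 / L * dist x₁ x₂) := by
      field_simp
    rw [h4]
    nlinarith
  · have h1 := (h (f x₁) (f x₂)).2
    have h2 := mul_le_mul_of_nonneg_left (h' x₁ x₂).2 hK0.le
    nlinarith
  · obtain ⟨y, hy⟩ := hs z
    obtain ⟨x, hx⟩ := hs' y
    refine ⟨x, ?_⟩
    have h1 := (h (f x) y).2
    have h2 := mul_le_mul_of_nonneg_left hx hK0.le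
    have h3 := dist_triangle (g (f x)) (g y) z
    linarith

/-- A quasi-isometry has a quasi-inverse. -/
theorem exists_quasiInverse {X Y : Type*} [MetricSpace X] [MetricSpace Y] {f : X → Y}
    (hf : IsQuasiIsometry f) :
    ∃ g : Y → X, IsQuasiIsometry g ∧ BoundedDist (fun x => g (f x)) (fun x => x) := by
  obtain ⟨K, C, hK, hC, h, hs⟩ := hf
  have hK0 : 0 < K := by linarith
  have lower : ∀ x₁ x₂ : X, dist x₁ x₂ ≤ K * dist (f x₁) (f x₂) + K * C := by
    intro x₁ x₂
    have h1 := mul_le_mul_of_nonneg_left (h x₁ x₂).1 hK0.le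
    have h2 : K * (1 / K * dist x₁ x₂ - C) = dist x₁ x₂ - K * C := by
      field_simp
    linarith
  choose g hg using hs
  have bd : ∀ x : X, dist (g (f x)) x ≤ 2 * K * C := by
    intro x
    have h1 := lower (g (f x)) x
    have h2 := mul_le_mul_of_nonneg_left (hg (f x)) hK0.le
    linarith
  have hKC : 0 ≤ K * C := by positivity
  have hCKC : C ≤ K * C := by nlinarith
  refine ⟨g, ⟨K, 3 * (K * C), hK, by positivity, fun y₁ y₂ => ⟨?_, ?_⟩,
    fun x => ⟨f x, by linarith [bd x]⟩⟩, _, bd⟩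
  · have h1 := (h (g y₁) (g y₂)).2
    have h2 := dist_triangle4 y₁ (f (g y₁)) (f (g y₂)) y₂
    have h3 := hg y₁
    have h4 := hg y₂
    rw [dist_comm] at h3
    have h5 : dist y₁ y₂ ≤ K * (dist (g y₁) (g y₂) + 3 * (K * C)) := by nlinarith
    have h6 : 1 / K * dist y₁ y₂ ≤ dist (g y₁) (g y₂) + 3 * (K * C) := by
      rw [one_div, inv_mul_le_iff₀ hK0]; exact h5
    linarith
  · have h1 := lower (g y₁) (g y₂)
    have h2 := dist_triangle4 (f (g y₁)) y₁ y₂ (f (g y₂))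
    have h3 := hg y₁
    have h4 := hg y₂
    rw [dist_comm] at h4
    have h5 := mul_le_mul_of_nonneg_left h2 hK0.le
    nlinarith

end IsQuasiIsometry

/-- Self-quasi-isometries of `X`, up to bounded distance. -/
def QISetoid (X : Type*) [MetricSpace X] : Setoid {f : X → X // IsQuasiIsometry f} where
  r f g := BoundedDist f.1 g.1
  iseqv :=
    { refl := fun f => ⟨0, fun x => by simp⟩
      symm := fun ⟨M, hM⟩ => ⟨M, fun x => by rw [dist_comm]; exact hM x⟩
      trans := fun ⟨M, hM⟩ ⟨N, hN⟩ =>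
        ⟨M + N, fun x => (dist_triangle _ _ _).trans (add_le_add (hM x) (hN x))⟩ }

/-- The quasi-isometry group `QI(X)`: classes of quasi-isometries `X → X` up to bounded distance,
under composition. -/
def QI (X : Type*) [MetricSpace X] : Type _ := Quotient (QISetoid X)

namespace QI

/-- The class of a quasi-isometry. -/
def mk {X : Type*} [MetricSpace X] (f : X → X) (hf : IsQuasiIsometry f) : QI X :=
  Quotient.mk (QISetoid X) ⟨f, hf⟩

theorem mk_eq_mk {X : Type*} [MetricSpace X] {f g : X → X} {hf : IsQuasiIsometry f}
    {hg : IsQuasiIsometry g} : mk f hf = mk g hg ↔ BoundedDist f g :=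
  ⟨fun h => Quotient.exact h, fun h => Quotient.sound h⟩

theorem ind {X : Type*} [MetricSpace X] {p : QI X → Prop}
    (h : ∀ f hf, p (mk f hf)) (a : QI X) : p a :=
  Quotient.ind (fun f => h f.1 f.2) a

instance {X : Type*} [MetricSpace X] : One (QI X) := ⟨mk (fun x => x) (IsQuasiIsometry.refl X)⟩

/-- Multiplication is composition of representatives. -/
instance {X : Type*} [MetricSpace X] : Mul (QI X) :=
  ⟨Quotient.map₂ (fun f g => ⟨fun x => f.1 (g.1 x), f.2.comp g.2⟩) (by
    rintro ⟨f, hf⟩ ⟨f', hf'⟩ ⟨M, hM⟩ ⟨g, hg⟩ ⟨g', hg'⟩ ⟨N, hN⟩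
    obtain ⟨K, C, hK, hC, h, -⟩ := id hf
    refine ⟨K * N + C + M, fun x => ?_⟩
    have h1 := (h (g x) (g' x)).2
    have h2 := mul_le_mul_of_nonneg_left (hN x) (by linarith : 0 ≤ K)
    have h3 := hM (g' x)
    have h4 := dist_triangle (f (g x)) (f (g' x)) (f' (g' x))
    dsimp only at *
    linarith)⟩

theorem one_def {X : Type*} [MetricSpace X] :
    (1 : QI X) = mk (fun x => x) (IsQuasiIsometry.refl X) := rfl

theorem mk_mul_mk {X : Type*} [MetricSpace X] {f g : X → X} (hf : IsQuasiIsometry f)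
    (hg : IsQuasiIsometry g) : mk f hf * mk g hg = mk (fun x => f (g x)) (hf.comp hg) := rfl

theorem exists_mul_eq_one {X : Type*} [MetricSpace X] (a : QI X) : ∃ b : QI X, b * a = 1 := by
  induction a using ind with
  | h f hf =>
    obtain ⟨g, hg, hgf⟩ := hf.exists_quasiInverse
    exact ⟨mk g hg, mk_eq_mk.2 hgf⟩

instance {X : Type*} [MetricSpace X] : Inv (QI X) :=
  ⟨fun a => Classical.choose (exists_mul_eq_one a)⟩

instance {X : Type*} [MetricSpace X] : Group (QI X) :=
  Group.ofLeftAxioms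
    (fun a b c => by
      induction a using ind with
      | h f hf =>
        induction b using ind with
        | h g hg =>
          induction c using ind with
          | h k hk => rfl)
    (fun a => by
      induction a using ind with
      | h f hf => rfl)
    (fun a => Classical.choose_spec (exists_mul_eq_one a))

end QI

/-- A group is locally indicable if every nontrivial finitely generated subgroup surjects
onto `ℤ`. -/
def IsLocallyIndicable (G : Type*) [Group G] : Prop :=
  ∀ H : Subgroup G, H.FG → H ≠ ⊥ →
    ∃ φ : H →* Multiplicative ℤ, Function.Surjective φ

/-- `PSL₂(ℝ)`. -/
abbrev PSL2R : Type := Matrix.ProjectiveSpecialLinearGroup (Fin 2) ℝ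

theorem circleVec_ne_zero (t : ℝ) :
    (![Real.cos (Real.pi * t), Real.sin (Real.pi * t)] : Fin 2 → ℝ) ≠ 0 := by
  intro h
  have h0 := congrFun h 0
  have h1 := congrFun h 1
  have h2 := Real.sin_sq_add_cos_sq (Real.pi * t)
  simp at h0 h1
  simp [h0, h1] at h2

/-- The universal covering `ℝ → ℝP¹` of the circle `ℝP¹ = ∂ℍ`, with deck group generated by
`t ↦ t + 1`. -/
def circleCover (t : ℝ) : Projectivization ℝ (Fin 2 → ℝ) :=
  Projectivization.mk ℝ ![Real.cos (Real.pi * t), Real.sin (Real.pi * t)] (circleVec_ne_zero t)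

/-- The lift to `Homeo(ℝ)` of a subgroup `Δ` of `PSL₂(ℝ)`: all homeomorphisms of `ℝ` that cover
the action on the circle `ℝP¹` of some element of `Δ`. -/
def liftToHomeo (Δ : Subgroup PSL2R) : Subgroup (ℝ ≃ₜ ℝ) where
  carrier := {f | ∃ g ∈ Δ, ∀ t : ℝ, circleCover (f t) = g • circleCover t}
  mul_mem' := by
    rintro f₁ f₂ ⟨g₁, hg₁, h₁⟩ ⟨g₂, hg₂, h₂⟩
    refine ⟨g₁ * g₂, Δ.mul_mem hg₁ hg₂, fun t => ?_⟩
    rw [mul_smul, ← h₂, ← h₁]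
    rfl
  one_mem' := ⟨1, Δ.one_mem, fun t => by rw [one_smul]; rfl⟩
  inv_mem' := by
    rintro f ⟨g, hg, h⟩
    refine ⟨g⁻¹, Δ.inv_mem hg, fun t => ?_⟩
    rw [eq_inv_smul_iff, ← h]
    exact congrArg circleCover (f.apply_symm_apply t)

/-- The conformal isomorphism `z ↦ (z - p) / (z - p̄)` from the upper half plane to the unit disc;
it sends `p` to `0` and the geodesics through `p` to diameters. -/
def discCoord (p z : UpperHalfPlane) : ℂ :=
  ((z : ℂ) - (p : ℂ)) / ((z : ℂ) - (starRingEnd ℂ) (p : ℂ))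

/-- The hyperbolic angle at `p` between the geodesic rays from `p` to `q` and to `r`
(for `q ≠ p` and `r ≠ p`). -/
def hyperbolicAngle (q p r : UpperHalfPlane) : ℝ :=
  InnerProductGeometry.angle (discCoord p q) (discCoord p r)

/-- `g` acts on the hyperbolic plane as the rotation about `p` by the angle `θ`
(counterclockwise). -/
def IsRotation (g : PSL2R) (p : UpperHalfPlane) (θ : ℝ) : Prop :=
  ∃ A : Matrix.SpecialLinearGroup (Fin 2) ℝ, (QuotientGroup.mk A : PSL2R) = g ∧
    ∀ z : UpperHalfPlane,
      discCoord p (A • z) = Complex.exp ((θ : ℂ) * Complex.I) * discCoord p z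

/-- `Δ` is a `(k, l, m)`-triangle group in `PSL₂(ℝ)`: it is generated by the rotations by `2π/k`,
`2π/l`, `2π/m` about the vertices of a hyperbolic triangle with interior angles
`π/k`, `π/l`, `π/m` at these vertices. -/
def IsTriangleGroup (k l m : ℕ) (Δ : Subgroup PSL2R) : Prop :=
  ∃ p q r : UpperHalfPlane, p ≠ q ∧ q ≠ r ∧ r ≠ p ∧
    hyperbolicAngle r p q = Real.pi / k ∧
    hyperbolicAngle p q r = Real.pi / l ∧
    hyperbolicAngle q r p = Real.pi / m ∧
    Δ = Subgroup.closure {g | IsRotation g p (2 * Real.pi / k) ∨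
      IsRotation g q (2 * Real.pi / l) ∨ IsRotation g r (2 * Real.pi / m)}

end

/-!
Conjugation by the exponential turns a homeomorphism `f` of `ℝ` commuting with `t ↦ t + 1` into a
homeomorphism `exp ∘ f ∘ log` of the half-line commuting with the dilation by `e`. It is
bi-Lipschitz, hence a quasi-isometry, if `f` is bi-Lipschitz, and by homogeneity it is at bounded
distance from the identity only if `f` is the identity (`toQI_injective`). So the lift `Γ` of a
triangle group embeds into `QI(ℝ₊)` once it is known to consist of bi-Lipschitz homeomorphisms
commuting with the unit translation `τ`; this is checked on generators.

An elliptic matrix `A` has no real eigenvector, so that the line of `A v` differs from that of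
`v` by an angle strictly between `-π` and `0`. This gives an explicit smooth lift to `ℝ` with
displacement in `(-1, 0)`. If `A` has order dividing `k` in `PSL₂(ℝ)`, the `k`-th power of the lift
covers the identity, so it is `τⁿ`, with `-k < n < 0` (`exists_covers_pow_eq`). The lifts `x, y, z`
of the three generating rotations generate `Γ` together with `τ` (`liftToHomeo_closure`).

The rotation about a vertex by twice the angle there is the product of the reflections in the two
adjacent sides, so the product of the three rotations in a suitable cyclic order is trivial in
`PSL₂(ℝ)` (`rotationMatrix_mul_eq_neg_one`), and the corresponding product of `x, y, z` is `τʲ` for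
some integer `j`. A homomorphism `χ` to `ℝ` thus satisfies `2 χ(x) = l χ(τ)`, `3 χ(y) = m χ(τ)`,
`7 χ(z) = n χ(τ)` and `χ(x) + χ(y) + χ(z) = j χ(τ)`. As `-7 < n < 0`, the number
`l / 2 + m / 3 + n / 7` is not an integer; therefore `χ(τ) = 0` and `χ = 0`
(`liftToHomeo_of_elliptic`). The exact values of the exponents are not needed.

Finally, the image of `Γ` in `QI(ℝ₊)` is a nontrivial finitely generated subgroup without a
surjection onto `ℤ`.
-/

/-! ### Bi-Lipschitz periodic homeomorphisms as quasi-isometries of the half-line -/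

noncomputable section

/-- The group of homeomorphisms of `ℝ` that commute with `t ↦ t + 1` and are Lipschitz together
with their inverses. -/
def periodicBiLipschitz : Subgroup (ℝ ≃ₜ ℝ) where
  carrier := {f | (∀ t, f (t + 1) = f t + 1) ∧
    (∃ K, LipschitzWith K f) ∧ ∃ K, LipschitzWith K f.symm}
  mul_mem' := by
    rintro f g ⟨hf, ⟨K, hK⟩, K', hK'⟩ ⟨hg, ⟨L, hL⟩, L', hL'⟩
    exact ⟨fun t => by simp [Homeomorph.mul_apply, hf, hg], ⟨K * L, hK.comp hL⟩,
      ⟨L' * K', hL'.comp hK'⟩⟩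
  one_mem' := ⟨fun t => rfl, ⟨1, LipschitzWith.id⟩, ⟨1, LipschitzWith.id⟩⟩
  inv_mem' := by
    rintro f ⟨hf, hK, hK'⟩
    refine ⟨fun t => ?_, hK', hK⟩
    apply f.injective
    rw [hf, Homeomorph.inv_apply, Homeomorph.inv_apply, f.apply_symm_apply, f.apply_symm_apply]

/-- The map `exp ∘ f ∘ log` of `[0, ∞)`, extended by `0 ↦ 0`. -/
def expConj (f : ℝ → ℝ) (s : Set.Ici (0 : ℝ)) : Set.Ici (0 : ℝ) :=
  ⟨if s.1 = 0 then 0 else Real.exp (f (Real.log s.1)), by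
    split_ifs
    exacts [Set.mem_Ici.2 le_rfl, Set.mem_Ici.2 (Real.exp_pos _).le]⟩

theorem expConj_of_eq_zero (f : ℝ → ℝ) {s : Set.Ici (0 : ℝ)} (hs : s.1 = 0) :
    (expConj f s).1 = 0 := if_pos hs

theorem expConj_of_ne_zero (f : ℝ → ℝ) {s : Set.Ici (0 : ℝ)} (hs : s.1 ≠ 0) :
    (expConj f s).1 = Real.exp (f (Real.log s.1)) := if_neg hs

theorem expConj_expConj (f g : ℝ → ℝ) (s : Set.Ici (0 : ℝ)) :
    expConj f (expConj g s) = expConj (fun t => f (g t)) s := by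
  apply Subtype.ext
  by_cases hs : s.1 = 0
  · rw [expConj_of_eq_zero _ hs, expConj_of_eq_zero _ (expConj_of_eq_zero _ hs)]
  · have h := expConj_of_ne_zero g hs
    have h0 : (expConj g s).1 ≠ 0 := by rw [h]; exact (Real.exp_pos _).ne'
    rw [expConj_of_ne_zero _ hs, expConj_of_ne_zero _ h0, h, Real.log_exp]

theorem expConj_id (s : Set.Ici (0 : ℝ)) : expConj (fun t => t) s = s := by
  apply Subtype.ext
  by_cases hs : s.1 = 0
  · rw [expConj_of_eq_zero _ hs, hs]
  · rw [expConj_of_ne_zero _ hs, Real.exp_log (lt_of_le_of_ne s.2 (Ne.symm hs))]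

theorem exists_abs_sub_le_of_map_add_one {f : ℝ → ℝ} (hf : Continuous f)
    (h1 : ∀ t, f (t + 1) = f t + 1) : ∃ C, ∀ t, |f t - t| ≤ C := by
  have hp : Function.Periodic (fun t => f t - t) 1 := fun t => by simp [h1]
  obtain ⟨C, hC⟩ := (hp.isBounded_of_continuous one_ne_zero
    (hf.sub continuous_id)).exists_norm_le
  exact ⟨C, fun t => hC _ ⟨t, rfl⟩⟩

theorem map_add_natCast_of_map_add_one {f : ℝ → ℝ} (h1 : ∀ t, f (t + 1) = f t + 1) (t : ℝ)
    (n : ℕ) : f (t + n) = f t + n := by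
  induction n with
  | zero => simp
  | succ n ih => rw [Nat.cast_succ, ← add_assoc, h1, ih, add_assoc]

/-- If `f` is Lipschitz and at bounded distance from the identity, then `exp ∘ f ∘ log` is
Lipschitz: for `s ≤ s'` the Lipschitz bound is used when `s' ≤ 2 s`, and otherwise the linear
growth of the map suffices. -/
theorem exists_dist_expConj_le {f : ℝ → ℝ} {K : NNReal} (hf : LipschitzWith K f) {C : ℝ}
    (hC : ∀ t, |f t - t| ≤ C) :
    ∃ L : ℝ, 0 ≤ L ∧ ∀ s s', dist (expConj f s) (expConj f s') ≤ L * dist s s' := by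
  have hK : (0 : ℝ) ≤ K := K.2
  have hE := Real.exp_pos C
  have bound : ∀ s : Set.Ici (0 : ℝ), (expConj f s).1 ≤ Real.exp C * s.1 := fun s => by
    by_cases hs : s.1 = 0
    · simp [expConj_of_eq_zero _ hs, hs]
    · have hs0 : 0 < s.1 := lt_of_le_of_ne s.2 (Ne.symm hs)
      rw [expConj_of_ne_zero _ hs]
      calc Real.exp (f (Real.log s.1)) ≤ Real.exp (C + Real.log s.1) :=
            Real.exp_le_exp.2 (by linarith [(abs_le.1 (hC (Real.log s.1))).2])
        _ = _ := by rw [Real.exp_add, Real.exp_log hs0]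
  have key : ∀ a b M : ℝ, Real.exp a ≤ M → Real.exp b ≤ M →
      |Real.exp a - Real.exp b| ≤ M * |a - b| := by
    intro a b M ha hb
    wlog hab : a ≤ b generalizing a b
    · rw [abs_sub_comm, abs_sub_comm a]
      exact this b a hb ha (le_of_not_ge hab)
    have h1 := Real.add_one_le_exp (a - b)
    have h2 : Real.exp a = Real.exp b * Real.exp (a - b) := by rw [← Real.exp_add]; ring_nf
    rw [abs_of_nonpos (by linarith [Real.exp_le_exp.2 hab]), abs_of_nonpos (by linarith)]
    have h3 := Real.exp_pos b
    nlinarith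
  refine ⟨2 * Real.exp C * (K + 1), by positivity, fun s s' => ?_⟩
  wlog hss : s.1 ≤ s'.1 generalizing s s'
  · rw [dist_comm, dist_comm s]
    exact this s' s (le_of_not_ge hss)
  have hs : 0 ≤ s.1 := s.2
  rw [Subtype.dist_eq, Subtype.dist_eq, Real.dist_eq, Real.dist_eq,
    abs_of_nonpos (by linarith : s.1 - s'.1 ≤ 0)]
  by_cases h2 : s'.1 ≤ 2 * s.1
  · rcases hs.eq_or_lt with h0 | hs0
    · have : s = s' := Subtype.ext (by linarith)
      simp [this]
    have hs'0 : 0 < s'.1 := by linarith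
    have b1 := bound s
    have b2 := bound s'
    rw [expConj_of_ne_zero _ hs0.ne'] at b1 ⊢
    rw [expConj_of_ne_zero _ hs'0.ne'] at b2 ⊢
    have h3 := hf.dist_le_mul (Real.log s.1) (Real.log s'.1)
    have hlog : |Real.log s.1 - Real.log s'.1| ≤ (s'.1 - s.1) / s.1 := by
      have h4 := Real.log_le_sub_one_of_pos (div_pos hs'0 hs0)
      rw [Real.log_div hs'0.ne' hs0.ne'] at h4
      rw [abs_of_nonpos (by linarith [Real.log_le_log hs0 hss]), sub_div, div_self hs0.ne']
      linarith
    rw [Real.dist_eq, Real.dist_eq] at h3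
    calc _ ≤ Real.exp C * s'.1 * |f (Real.log s.1) - f (Real.log s'.1)| :=
          key _ _ _ (b1.trans (by gcongr)) b2
      _ ≤ Real.exp C * s'.1 * (K * ((s'.1 - s.1) / s.1)) := by
          gcongr
          exact h3.trans (by gcongr)
      _ = Real.exp C * K * (s'.1 - s.1) * (s'.1 / s.1) := by ring
      _ ≤ Real.exp C * K * (s'.1 - s.1) * 2 := by
          have : 0 ≤ s'.1 - s.1 := by linarith
          gcongr
          rwa [div_le_iff₀ hs0]
      _ ≤ _ := by nlinarith
  · push Not at h2
    have b1 := bound s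
    have b2 := bound s'
    have c1 : 0 ≤ (expConj f s).1 := (expConj f s).2
    have c2 : 0 ≤ (expConj f s').1 := (expConj f s').2
    have h3 : |(expConj f s).1 - (expConj f s').1| ≤ Real.exp C * s'.1 := by
      have : Real.exp C * s.1 ≤ Real.exp C * s'.1 := by gcongr
      rw [abs_le]
      constructor <;> linarith
    have h4 : Real.exp C * s'.1 ≤ 2 * Real.exp C * (s'.1 - s.1) := by nlinarith
    have h5 : 0 ≤ 2 * Real.exp C * K * (s'.1 - s.1) := by
      have : 0 ≤ s'.1 - s.1 := by linarith
      positivity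
    nlinarith

/-- A bijection of a metric space that is Lipschitz together with its inverse is a
quasi-isometry. -/
theorem isQuasiIsometry_of_dist_le {X : Type*} [MetricSpace X] {f g : X → X} {L L' : ℝ}
    (hL : 0 ≤ L) (hL' : 0 ≤ L') (hf : ∀ x y, dist (f x) (f y) ≤ L * dist x y)
    (hg : ∀ x y, dist (g x) (g y) ≤ L' * dist x y) (hgf : ∀ x, g (f x) = x)
    (hfg : ∀ x, f (g x) = x) : IsQuasiIsometry f := by
  refine ⟨L + L' + 1, 0, by linarith, le_rfl, fun x y => ⟨?_, ?_⟩, fun y => ⟨g y, ?_⟩⟩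
  · rw [sub_zero, one_div, inv_mul_le_iff₀ (by positivity)]
    have h := hg (f x) (f y)
    rw [hgf, hgf] at h
    have h0 : 0 ≤ dist (f x) (f y) := dist_nonneg
    nlinarith
  · have h := hf x y
    have h0 : 0 ≤ dist x y := dist_nonneg
    nlinarith
  · simp [hfg]

theorem isQuasiIsometry_expConj {f : ℝ ≃ₜ ℝ} (hf : f ∈ periodicBiLipschitz) :
    IsQuasiIsometry (expConj f) := by
  have hf' := periodicBiLipschitz.inv_mem hf
  obtain ⟨h1, ⟨K, hK⟩, -⟩ := hf
  obtain ⟨h1', ⟨K', hK'⟩, -⟩ := hf'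
  obtain ⟨C, hC⟩ := exists_abs_sub_le_of_map_add_one f.continuous h1
  obtain ⟨C', hC'⟩ := exists_abs_sub_le_of_map_add_one (f⁻¹).continuous h1'
  obtain ⟨L, hL, h⟩ := exists_dist_expConj_le hK hC
  obtain ⟨L', hL', h'⟩ := exists_dist_expConj_le hK' hC'
  refine isQuasiIsometry_of_dist_le hL hL' h h' (fun s => ?_) (fun s => ?_)
  · rw [expConj_expConj]
    simp only [Homeomorph.inv_apply, Homeomorph.symm_apply_apply, expConj_id]
  · rw [expConj_expConj]
    simp only [Homeomorph.inv_apply, Homeomorph.apply_symm_apply, expConj_id]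

/-- The homomorphism sending `f` to the class of the quasi-isometry `exp ∘ f ∘ log` of `[0, ∞)`.
Conjugation by the exponential turns the translation `t ↦ t + 1` into the dilation by `e`, so
that the quasi-isometries obtained commute with this dilation. -/
def toQI : periodicBiLipschitz →* QI (Set.Ici (0 : ℝ)) where
  toFun f := QI.mk (expConj f.1) (isQuasiIsometry_expConj f.2)
  map_one' := by
    rw [QI.one_def, QI.mk_eq_mk]
    refine ⟨0, fun s => ?_⟩
    rw [dist_le_zero]
    exact expConj_id s
  map_mul' f g := by
    rw [QI.mk_mul_mk, QI.mk_eq_mk]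
    refine ⟨0, fun s => ?_⟩
    rw [dist_le_zero]
    exact (expConj_expConj f.1 g.1 s).symm

/-- If `exp ∘ f ∘ log` is at bounded distance from the identity, then applying the bound at the
points `eⁿ s` and dividing by `eⁿ` shows that it is the identity. -/
theorem toQI_injective : Function.Injective toQI := by
  rw [injective_iff_map_eq_one]
  intro f hf
  obtain ⟨M, hM⟩ := QI.mk_eq_mk.1 (hf.trans QI.one_def)
  have key : ∀ (t : ℝ) (n : ℕ), |Real.exp (f.1 t) - Real.exp t| * Real.exp n ≤ M := by
    intro t n
    have h := hM ⟨Real.exp (t + n), Set.mem_Ici.2 (Real.exp_pos _).le⟩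
    change |_ - Real.exp (t + n)| ≤ M at h
    rw [expConj_of_ne_zero _ (Real.exp_pos _).ne', Real.log_exp,
      map_add_natCast_of_map_add_one f.2.1, Real.exp_add, Real.exp_add,
      ← sub_mul, abs_mul, Real.abs_exp] at h
    exact h
  apply Subtype.ext
  apply Homeomorph.ext
  intro t
  apply Real.exp_injective
  by_contra hne
  have hpos : 0 < |Real.exp (f.1 t) - Real.exp t| := abs_pos.2 (sub_ne_zero.2 hne)
  obtain ⟨n, hn⟩ := exists_nat_gt (M / |Real.exp (f.1 t) - Real.exp t|)
  rw [div_lt_iff₀ hpos] at hn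
  have h1 := key t n
  have h2 := Real.add_one_le_exp (n : ℝ)
  nlinarith

end

/-! ### Lifting elliptic elements to the line -/

noncomputable section

theorem circleCover_eq_iff {s t : ℝ} :
    circleCover s = circleCover t ↔ ∃ n : ℤ, s = t + n := by
  unfold circleCover
  rw [Projectivization.mk_eq_mk_iff']
  constructor
  · rintro ⟨a, ha⟩
    have h0 := congrFun ha 0
    have h1 := congrFun ha 1
    simp at h0 h1
    have h2 : Real.sin (Real.pi * s - Real.pi * t) = 0 := by
      rw [Real.sin_sub, ← h0, ← h1]; ring
    obtain ⟨n, hn⟩ := Real.sin_eq_zero_iff.1 h2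
    refine ⟨n, mul_left_cancel₀ Real.pi_ne_zero ?_⟩
    linear_combination -hn
  · rintro ⟨n, rfl⟩
    refine ⟨(-1) ^ n, ?_⟩
    have h : Real.pi * (t + n) = Real.pi * t + n * Real.pi := by ring
    rw [h, Real.cos_add_int_mul_pi, Real.sin_add_int_mul_pi]
    ext i
    fin_cases i <;> simp

/-- The homeomorphism `f` of `ℝ` covers the action of `g` on the circle `ℝP¹`. -/
def Covers (f : ℝ ≃ₜ ℝ) (g : PSL2R) : Prop :=
  ∀ t : ℝ, circleCover (f t) = g • circleCover t

theorem Covers.one : Covers 1 1 := fun t => by rw [one_smul]; rfl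

theorem Covers.mul {f f' : ℝ ≃ₜ ℝ} {g g' : PSL2R} (h : Covers f g) (h' : Covers f' g') :
    Covers (f * f') (g * g') := fun t => by
  rw [mul_smul, ← h', ← h, Homeomorph.mul_apply]

theorem Covers.inv {f : ℝ ≃ₜ ℝ} {g : PSL2R} (h : Covers f g) : Covers f⁻¹ g⁻¹ := fun t => by
  rw [eq_inv_smul_iff, ← h, Homeomorph.inv_apply, f.apply_symm_apply]

theorem Covers.pow {f : ℝ ≃ₜ ℝ} {g : PSL2R} (h : Covers f g) (n : ℕ) : Covers (f ^ n) (g ^ n) := by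
  induction n with
  | zero => simpa using Covers.one
  | succ n ih => simpa [pow_succ] using ih.mul h

/-- The generator `t ↦ t + 1` of the deck group of the covering of the circle. -/
def unitTranslation : ℝ ≃ₜ ℝ := Homeomorph.addRight 1

theorem unitTranslation_apply (t : ℝ) : unitTranslation t = t + 1 := rfl

theorem unitTranslation_zpow_apply (n : ℤ) (t : ℝ) : (unitTranslation ^ n) t = t + n := by
  induction n generalizing t with
  | zero => simp
  | succ n ih =>
    rw [zpow_add_one, Homeomorph.mul_apply, ih, unitTranslation_apply]; push_cast; ring
  | pred n ih =>
    have h : unitTranslation⁻¹ t = t - 1 := by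
      rw [Homeomorph.inv_apply, Homeomorph.symm_apply_eq, unitTranslation_apply]; ring
    rw [zpow_sub_one, Homeomorph.mul_apply, ih, h]; push_cast; ring

theorem covers_unitTranslation : Covers unitTranslation 1 := fun t => by
  rw [one_smul, circleCover_eq_iff]
  exact ⟨1, by simp [unitTranslation_apply]⟩

theorem unitTranslation_mem : unitTranslation ∈ periodicBiLipschitz :=
  ⟨fun _ => rfl, ⟨1, (IsometryEquiv.addRight (1 : ℝ)).isometry.lipschitz⟩,
    ⟨1, (IsometryEquiv.addRight (1 : ℝ)).symm.isometry.lipschitz⟩⟩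

theorem exists_eq_add_intCast_of_circleCover_eq {f : ℝ → ℝ} (hf : Continuous f)
    (h : ∀ t, circleCover (f t) = circleCover t) : ∃ n : ℤ, ∀ t, f t = t + n := by
  choose n hn using fun t => circleCover_eq_iff.1 (h t)
  have hc : Continuous n := by
    rw [Int.isClosedEmbedding_coe_real.isEmbedding.continuous_iff]
    have : (Int.cast ∘ n : ℝ → ℝ) = fun t => f t - t := by
      funext t
      simp [hn t]
    rw [this]
    exact hf.sub continuous_id
  refine ⟨n 0, fun t => ?_⟩
  rw [hn t, PreconnectedSpace.constant inferInstance hc (x := t) (y := 0)]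

theorem Covers.exists_eq_zpow {f : ℝ ≃ₜ ℝ} (h : Covers f 1) :
    ∃ n : ℤ, f = unitTranslation ^ n := by
  obtain ⟨n, hn⟩ := exists_eq_add_intCast_of_circleCover_eq f.continuous
    fun t => (h t).trans (one_smul _ _)
  exact ⟨n, Homeomorph.ext fun t => by rw [hn, unitTranslation_zpow_apply]⟩

theorem exists_lipschitzWith_of_map_add_one {f : ℝ → ℝ} (hf : ContDiff ℝ 1 f)
    (h1 : ∀ t, f (t + 1) = f t + 1) : ∃ K, LipschitzWith K f := by
  have hp : Function.Periodic (deriv f) 1 := fun t => by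
    rw [← deriv_comp_add_const, funext h1, deriv_add_const]
  obtain ⟨C, hC⟩ := (hp.isBounded_of_continuous one_ne_zero
    (hf.continuous_deriv le_rfl)).exists_norm_le
  refine ⟨C.toNNReal, lipschitzWith_of_nnnorm_deriv_le (hf.differentiable one_ne_zero)
    fun x => ?_⟩
  rw [← NNReal.coe_le_coe, coe_nnnorm]
  exact (hC _ ⟨x, rfl⟩).trans (Real.le_coe_toNNReal C)

open Matrix

/-- The inner product `⟨v, A v⟩` for the unit vector `v` at angle `π t`. -/
def dotForm (A : SpecialLinearGroup (Fin 2) ℝ) (t : ℝ) : ℝ :=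
  A.1 0 0 * Real.cos (Real.pi * t) ^ 2 +
    (A.1 0 1 + A.1 1 0) * Real.cos (Real.pi * t) * Real.sin (Real.pi * t) +
    A.1 1 1 * Real.sin (Real.pi * t) ^ 2

/-- The determinant `v × A v` for the unit vector `v` at angle `π t`. -/
def crossForm (A : SpecialLinearGroup (Fin 2) ℝ) (t : ℝ) : ℝ :=
  A.1 1 0 * Real.cos (Real.pi * t) ^ 2 +
    (A.1 1 1 - A.1 0 0) * Real.cos (Real.pi * t) * Real.sin (Real.pi * t) -
    A.1 0 1 * Real.sin (Real.pi * t) ^ 2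

/-- An elliptic matrix has no real eigenvector. -/
theorem crossForm_ne_zero {A : SpecialLinearGroup (Fin 2) ℝ} (hA : A.1.IsElliptic) (t : ℝ) :
    crossForm A t ≠ 0 := by
  intro h
  have hd := A.2
  rw [det_fin_two] at hd
  have hA' : (A.1 0 0 + A.1 1 1) ^ 2 - 4 < 0 := by
    have := hA
    rwa [IsElliptic, discr_fin_two, A.2, trace_fin_two, mul_one] at this
  have hcs := Real.sin_sq_add_cos_sq (Real.pi * t)
  unfold crossForm at h
  generalize Real.cos (Real.pi * t) = c at *
  generalize Real.sin (Real.pi * t) = s at *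
  have h4 : (2 * A.1 1 0 * c + (A.1 1 1 - A.1 0 0) * s) ^ 2 +
      (4 - (A.1 0 0 + A.1 1 1) ^ 2) * s ^ 2 = 0 := by
    linear_combination 4 * A.1 1 0 * h - 4 * s ^ 2 * hd
  have hs : s = 0 := by
    by_contra hs
    have : 0 < s ^ 2 := by positivity
    nlinarith [sq_nonneg (2 * A.1 1 0 * c + (A.1 1 1 - A.1 0 0) * s)]
  subst hs
  have hc : A.1 1 0 = 0 := by
    have : A.1 1 0 * (0 ^ 2 + c ^ 2) = 0 := by linear_combination h
    rwa [hcs, mul_one] at this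
  rw [hc] at hd
  nlinarith [sq_nonneg (A.1 0 0 - A.1 1 1)]

/-- The lift of an elliptic element to `ℝ` with displacement in `(-1, 0)`: the vector `A v` is at
angle `-π/2 - arctan (⟨v, A v⟩ / v × A v)` from `v`, up to multiples of `π`. -/
def ellipticLift (A : SpecialLinearGroup (Fin 2) ℝ) (t : ℝ) : ℝ :=
  t - 1 / 2 - Real.arctan (dotForm A t / crossForm A t) / Real.pi

theorem ellipticLift_lt (A : SpecialLinearGroup (Fin 2) ℝ) (t : ℝ) : ellipticLift A t < t := by
  have h := Real.neg_pi_div_two_lt_arctan (dotForm A t / crossForm A t)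
  have h2 : -(1 / 2) < Real.arctan (dotForm A t / crossForm A t) / Real.pi := by
    rw [lt_div_iff₀ Real.pi_pos]; linarith
  unfold ellipticLift
  linarith

theorem sub_one_lt_ellipticLift (A : SpecialLinearGroup (Fin 2) ℝ) (t : ℝ) :
    t - 1 < ellipticLift A t := by
  have h := Real.arctan_lt_pi_div_two (dotForm A t / crossForm A t)
  have h2 : Real.arctan (dotForm A t / crossForm A t) / Real.pi < 1 / 2 := by
    rw [div_lt_iff₀ Real.pi_pos]; linarith
  unfold ellipticLift
  linarith

theorem ellipticLift_add_one (A : SpecialLinearGroup (Fin 2) ℝ) (t : ℝ) :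
    ellipticLift A (t + 1) = ellipticLift A t + 1 := by
  simp only [ellipticLift, dotForm, crossForm, mul_add, mul_one, Real.cos_add_pi,
    Real.sin_add_pi, neg_sq, mul_neg, neg_mul, neg_neg]
  ring

theorem contDiff_ellipticLift {A : SpecialLinearGroup (Fin 2) ℝ} (hA : A.1.IsElliptic) :
    ContDiff ℝ 1 (ellipticLift A) := by
  have h1 : ContDiff ℝ 1 (dotForm A) := by unfold dotForm; fun_prop
  have h2 : ContDiff ℝ 1 (crossForm A) := by unfold crossForm; fun_prop
  exact (contDiff_id.sub contDiff_const).sub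
    ((h1.div h2 (crossForm_ne_zero hA)).arctan.div_const _)

theorem circleCover_ellipticLift {A : SpecialLinearGroup (Fin 2) ℝ} (hA : A.1.IsElliptic) (t : ℝ) :
    circleCover (ellipticLift A t) = (QuotientGroup.mk A : PSL2R) • circleCover t := by
  have hQ := crossForm_ne_zero hA t
  have hcs := Real.sin_sq_add_cos_sq (Real.pi * t)
  refine (Projectivization.mk_eq_mk_iff' ℝ _ (A.1 *ᵥ _) _ _).2 ?_
  have hφ := Real.cos_arctan_pos (dotForm A t / crossForm A t)
  have hsin : Real.sin (Real.arctan (dotForm A t / crossForm A t)) * crossForm A t =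
      Real.cos (Real.arctan (dotForm A t / crossForm A t)) * dotForm A t := by
    have h := Real.tan_arctan (dotForm A t / crossForm A t)
    rw [Real.tan_eq_sin_div_cos, div_eq_div_iff hφ.ne' hQ] at h
    linarith
  have harg : Real.pi * ellipticLift A t =
      Real.pi * t - Real.arctan (dotForm A t / crossForm A t) - Real.pi / 2 := by
    unfold ellipticLift
    field_simp
    ring
  rw [harg, Real.cos_sub_pi_div_two, Real.sin_sub_pi_div_two, Real.sin_sub, Real.cos_sub]
  generalize Real.arctan (dotForm A t / crossForm A t) = φ at *
  -- `A v = ⟨v, A v⟩ v + (v × A v) v^⊥`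
  have e0 : A.1 0 0 * Real.cos (Real.pi * t) + A.1 0 1 * Real.sin (Real.pi * t) =
      dotForm A t * Real.cos (Real.pi * t) - crossForm A t * Real.sin (Real.pi * t) := by
    unfold dotForm crossForm
    linear_combination -(A.1 0 0 * Real.cos (Real.pi * t) + A.1 0 1 * Real.sin (Real.pi * t)) * hcs
  have e1 : A.1 1 0 * Real.cos (Real.pi * t) + A.1 1 1 * Real.sin (Real.pi * t) =
      dotForm A t * Real.sin (Real.pi * t) + crossForm A t * Real.cos (Real.pi * t) := by
    unfold dotForm crossForm
    linear_combination -(A.1 1 0 * Real.cos (Real.pi * t) + A.1 1 1 * Real.sin (Real.pi * t)) * hcs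
  refine ⟨-Real.cos φ / crossForm A t, ?_⟩
  ext i
  fin_cases i
  · simp [e0]
    field_simp
    linear_combination Real.cos (Real.pi * t) * hsin
  · simp [e1]
    field_simp
    linear_combination Real.sin (Real.pi * t) * hsin

theorem isElliptic_inv {A : SpecialLinearGroup (Fin 2) ℝ} (hA : A.1.IsElliptic) :
    (A⁻¹).1.IsElliptic := by
  unfold IsElliptic at *
  rw [discr_fin_two, A.2, trace_fin_two] at hA
  rw [discr_fin_two, (A⁻¹).2, trace_fin_two]
  simpa [SpecialLinearGroup.SL2_inv_expl, add_comm] using hA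

theorem ellipticLift_inv_ellipticLift {A : SpecialLinearGroup (Fin 2) ℝ} (hA : A.1.IsElliptic)
    (t : ℝ) : ellipticLift A⁻¹ (ellipticLift A t) + 1 = t := by
  have hA' := isElliptic_inv hA
  obtain ⟨n, hn⟩ := exists_eq_add_intCast_of_circleCover_eq
    ((contDiff_ellipticLift hA').continuous.comp (contDiff_ellipticLift hA).continuous) fun t => by
      rw [Function.comp_apply, circleCover_ellipticLift hA', circleCover_ellipticLift hA,
        ← mul_smul, QuotientGroup.mk_inv, inv_mul_cancel, one_smul]
  have h := hn t
  rw [Function.comp_apply] at h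
  have h1 := ellipticLift_lt A t
  have h2 := ellipticLift_lt A⁻¹ (ellipticLift A t)
  have h3 := sub_one_lt_ellipticLift A t
  have h4 := sub_one_lt_ellipticLift A⁻¹ (ellipticLift A t)
  have h5 : (n : ℝ) < (0 : ℤ) := by push_cast; linarith
  have h6 : ((-2 : ℤ) : ℝ) < n := by push_cast; linarith
  have h7 : n = -1 := by
    have := Int.cast_lt.1 h5
    have := Int.cast_lt.1 h6
    omega
  rw [h, h7]
  push_cast
  ring

/-- The homeomorphism `ellipticLift A` of `ℝ`. -/
def ellipticHomeo (A : SpecialLinearGroup (Fin 2) ℝ) (hA : A.1.IsElliptic) : ℝ ≃ₜ ℝ where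
  toFun := ellipticLift A
  invFun t := ellipticLift A⁻¹ t + 1
  left_inv := ellipticLift_inv_ellipticLift hA
  right_inv t := by
    change ellipticLift A (ellipticLift A⁻¹ t + 1) = t
    rw [ellipticLift_add_one]
    simpa only [inv_inv] using ellipticLift_inv_ellipticLift (isElliptic_inv hA) t
  continuous_toFun := (contDiff_ellipticLift hA).continuous
  continuous_invFun := (contDiff_ellipticLift (isElliptic_inv hA)).continuous.add continuous_const

theorem ellipticHomeo_mem {A : SpecialLinearGroup (Fin 2) ℝ} (hA : A.1.IsElliptic) :
    ellipticHomeo A hA ∈ periodicBiLipschitz := by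
  refine ⟨ellipticLift_add_one A,
    exists_lipschitzWith_of_map_add_one (contDiff_ellipticLift hA) (ellipticLift_add_one A),
    exists_lipschitzWith_of_map_add_one (f := fun t => ellipticLift A⁻¹ t + 1)
      ((contDiff_ellipticLift (isElliptic_inv hA)).add contDiff_const)
      fun t => by rw [ellipticLift_add_one]⟩

theorem covers_ellipticHomeo {A : SpecialLinearGroup (Fin 2) ℝ} (hA : A.1.IsElliptic) :
    Covers (ellipticHomeo A hA) (QuotientGroup.mk A) :=
  circleCover_ellipticLift hA

/-- An elliptic element of order `k` has a lift whose `k`-th power is the translation by an integer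
in the open interval `(-k, 0)`; in particular this integer is not divisible by `k`. -/
theorem exists_covers_pow_eq {A : SpecialLinearGroup (Fin 2) ℝ} (hA : A.1.IsElliptic) {k : ℕ}
    (hk : 0 < k) (hAk : (QuotientGroup.mk A : PSL2R) ^ k = 1) :
    ∃ f ∈ periodicBiLipschitz, Covers f (QuotientGroup.mk A) ∧
      ∃ n : ℤ, -(k : ℤ) < n ∧ n < 0 ∧ f ^ k = unitTranslation ^ n := by
  refine ⟨ellipticHomeo A hA, ellipticHomeo_mem hA, covers_ellipticHomeo hA, ?_⟩
  have hc := (covers_ellipticHomeo hA).pow k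
  rw [hAk] at hc
  obtain ⟨n, hn⟩ := hc.exists_eq_zpow
  have bound : ∀ m : ℕ, ∀ t : ℝ, t - (m + 1 : ℕ) < (ellipticHomeo A hA ^ (m + 1)) t ∧
      (ellipticHomeo A hA ^ (m + 1)) t < t := by
    intro m
    induction m with
    | zero =>
      intro t
      rw [zero_add, pow_one, Nat.cast_one]
      exact ⟨sub_one_lt_ellipticLift A t, ellipticLift_lt A t⟩
    | succ m ih =>
      intro t
      rw [pow_succ, Homeomorph.mul_apply]
      have h1 := ih (ellipticHomeo A hA t)
      have h2 : t - 1 < ellipticHomeo A hA t := sub_one_lt_ellipticLift A t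
      have h3 : ellipticHomeo A hA t < t := ellipticLift_lt A t
      push_cast at *
      constructor <;> linarith
  have h := bound (k - 1) 0
  rw [Nat.sub_add_cancel hk, hn, unitTranslation_zpow_apply] at h
  refine ⟨n, ?_, ?_, hn⟩
  · have : ((-(k : ℤ) : ℤ) : ℝ) < n := by push_cast; linarith
    exact_mod_cast this
  · have : (n : ℝ) < (0 : ℤ) := by push_cast; linarith
    exact_mod_cast this

end

/-! ### Generators of the lift and its homomorphisms to the reals -/

noncomputable section

/-- The lift of a group is generated by lifts of its generators and the unit translation. -/
theorem liftToHomeo_closure {a b c : PSL2R} {x y z : ℝ ≃ₜ ℝ} (hx : Covers x a) (hy : Covers y b)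
    (hz : Covers z c) : liftToHomeo (Subgroup.closure {a, b, c}) =
      Subgroup.closure {x, y, z, unitTranslation} := by
  apply le_antisymm
  · rintro f ⟨g, hg, hf⟩
    obtain ⟨w, hw, hwg⟩ : ∃ w ∈ Subgroup.closure {x, y, z, unitTranslation}, Covers w g := by
      clear hf
      induction hg using Subgroup.closure_induction with
      | mem g hg =>
        rcases hg with rfl | rfl | rfl
        · exact ⟨x, Subgroup.subset_closure (by simp), hx⟩
        · exact ⟨y, Subgroup.subset_closure (by simp), hy⟩
        · exact ⟨z, Subgroup.subset_closure (by simp), hz⟩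
      | one => exact ⟨1, Subgroup.one_mem _, Covers.one⟩
      | mul g g' _ _ h h' =>
        obtain ⟨w, hw, hwg⟩ := h
        obtain ⟨w', hw', hwg'⟩ := h'
        exact ⟨w * w', Subgroup.mul_mem _ hw hw', hwg.mul hwg'⟩
      | inv g _ h =>
        obtain ⟨w, hw, hwg⟩ := h
        exact ⟨w⁻¹, Subgroup.inv_mem _ hw, hwg.inv⟩
    have hf' : Covers f g := hf
    have h1 := hwg.inv.mul hf'
    rw [inv_mul_cancel] at h1
    obtain ⟨n, hn⟩ := h1.exists_eq_zpow
    rw [inv_mul_eq_iff_eq_mul] at hn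
    rw [hn]
    exact Subgroup.mul_mem _ hw (Subgroup.zpow_mem _ (Subgroup.subset_closure (by simp)) _)
  · rw [Subgroup.closure_le]
    rintro f (rfl | rfl | rfl | rfl)
    · exact ⟨a, Subgroup.subset_closure (by simp), hx⟩
    · exact ⟨b, Subgroup.subset_closure (by simp), hy⟩
    · exact ⟨c, Subgroup.subset_closure (by simp), hz⟩
    · exact ⟨1, Subgroup.one_mem _, covers_unitTranslation⟩

/-- The relations `x² = τˡ`, `y³ = τᵐ`, `z⁷ = τⁿ`, `x y z = τʲ`, written additively, have only the
trivial solution in `ℝ` when `7 ∤ n`, as then `l / 2 + m / 3 + n / 7` is not the integer `j`. -/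
theorem eq_zero_of_relations {ξ η ζ T : ℝ} {l m n j : ℤ} (hx : 2 * ξ = l * T)
    (hy : 3 * η = m * T) (hz : 7 * ζ = n * T) (hxyz : ξ + η + ζ = j * T) (hn : ¬ (7 : ℤ) ∣ n) :
    ξ = 0 ∧ η = 0 ∧ ζ = 0 ∧ T = 0 := by
  have h : ((21 * l + 14 * m + 6 * n - 42 * j : ℤ) : ℝ) * T = 0 := by
    push_cast
    linear_combination 42 * hxyz - 21 * hx - 14 * hy - 6 * hz
  have hT : T = 0 := by
    refine (mul_eq_zero.1 h).resolve_left fun h0 => ?_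
    have h1 := Int.cast_eq_zero.1 h0
    omega
  subst hT
  refine ⟨?_, ?_, ?_, rfl⟩ <;> linarith

open Matrix in
/-- The lift of a group generated by elliptic elements `a`, `b`, `c` with `a² = b³ = c⁷ = 1` and
with `a b c = 1` or `c b a = 1`. -/
theorem liftToHomeo_of_elliptic {A B C : SpecialLinearGroup (Fin 2) ℝ} (hA : A.1.IsElliptic)
    (hB : B.1.IsElliptic) (hC : C.1.IsElliptic) {a b c : PSL2R} (ha : QuotientGroup.mk A = a)
    (hb : QuotientGroup.mk B = b) (hc : QuotientGroup.mk C = c) (ha2 : a ^ 2 = 1)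
    (hb3 : b ^ 3 = 1) (hc7 : c ^ 7 = 1) (habc : a * b * c = 1 ∨ c * b * a = 1) :
    liftToHomeo (Subgroup.closure {a, b, c}) ≤ periodicBiLipschitz ∧
      (liftToHomeo (Subgroup.closure {a, b, c})).FG ∧
      ∀ χ : liftToHomeo (Subgroup.closure {a, b, c}) →* Multiplicative ℝ, χ = 1 := by
  obtain ⟨x, hxm, hx, l, -, -, hxl⟩ := exists_covers_pow_eq hA two_pos (by rw [ha, ha2])
  obtain ⟨y, hym, hy, m, -, -, hym'⟩ := exists_covers_pow_eq hB three_pos (by rw [hb, hb3])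
  obtain ⟨z, hzm, hz, n, hn1, hn2, hzn⟩ :=
    exists_covers_pow_eq hC (Nat.succ_pos 6) (by rw [hc, hc7])
  rw [ha] at hx
  rw [hb] at hy
  rw [hc] at hz
  have hcl := liftToHomeo_closure hx hy hz
  have hle : liftToHomeo (Subgroup.closure {a, b, c}) ≤ periodicBiLipschitz := by
    rw [hcl, Subgroup.closure_le]
    rintro f (rfl | rfl | rfl | rfl)
    exacts [hxm, hym, hzm, unitTranslation_mem]
  refine ⟨hle, ?_, fun χ => ?_⟩
  · rw [Subgroup.fg_iff]
    exact ⟨_, hcl.symm, Set.toFinite _⟩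
  obtain ⟨j, hj⟩ : ∃ j : ℤ, x * y * z = unitTranslation ^ j ∨ z * y * x = unitTranslation ^ j := by
    rcases habc with h | h
    · obtain ⟨j, hj⟩ := Covers.exists_eq_zpow (h ▸ (hx.mul hy).mul hz)
      exact ⟨j, Or.inl hj⟩
    · obtain ⟨j, hj⟩ := Covers.exists_eq_zpow (h ▸ (hz.mul hy).mul hx)
      exact ⟨j, Or.inr hj⟩
  generalize liftToHomeo (Subgroup.closure {a, b, c}) = Γ at *
  subst hcl
  let x' : Subgroup.closure {x, y, z, unitTranslation} := ⟨x, Subgroup.subset_closure (by simp)⟩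
  let y' : Subgroup.closure {x, y, z, unitTranslation} := ⟨y, Subgroup.subset_closure (by simp)⟩
  let z' : Subgroup.closure {x, y, z, unitTranslation} := ⟨z, Subgroup.subset_closure (by simp)⟩
  let τ : Subgroup.closure {x, y, z, unitTranslation} :=
    ⟨unitTranslation, Subgroup.subset_closure (by simp)⟩
  have ex : 2 * (χ x').toAdd = l * (χ τ).toAdd := by
    have h : x' ^ 2 = τ ^ l := Subtype.ext hxl
    simpa using congrArg (fun g => (χ g).toAdd) h
  have ey : 3 * (χ y').toAdd = m * (χ τ).toAdd := by
    have h : y' ^ 3 = τ ^ m := Subtype.ext hym'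
    simpa using congrArg (fun g => (χ g).toAdd) h
  have ez : 7 * (χ z').toAdd = n * (χ τ).toAdd := by
    have h : z' ^ 7 = τ ^ n := Subtype.ext hzn
    simpa using congrArg (fun g => (χ g).toAdd) h
  have exyz : (χ x').toAdd + (χ y').toAdd + (χ z').toAdd = j * (χ τ).toAdd := by
    rcases hj with h | h
    · have h : x' * y' * z' = τ ^ j := Subtype.ext h
      simpa using congrArg (fun g => (χ g).toAdd) h
    · have h : z' * y' * x' = τ ^ j := Subtype.ext h
      have h' := congrArg (fun g => (χ g).toAdd) h
      simp at h'
      linarith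
  obtain ⟨h1, h2, h3, h4⟩ := eq_zero_of_relations ex ey ez exyz (by omega)
  ext ⟨f, hf⟩
  suffices χ ⟨f, hf⟩ = 1 by rw [this]; rfl
  induction hf using Subgroup.closure_induction with
  | mem f hf =>
    rcases hf with rfl | rfl | rfl | rfl
    exacts [h1, h2, h3, h4]
  | one => exact map_one χ
  | mul f f' hf hf' h h' =>
    have := map_mul χ ⟨f, hf⟩ ⟨f', hf'⟩
    rwa [h, h', one_mul] at this
  | inv f hf h =>
    have := map_inv χ ⟨f, hf⟩
    rwa [h, inv_one] at this

end

/-! ### Rotations of the hyperbolic plane as matrices -/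

noncomputable section
open Matrix

/-- The matrix `cos α + sin α J`, where `J` is the matrix of trace zero and determinant one that
fixes `p`; it acts as the rotation by `2 α` about `p`. -/
def rotationMatrix (p : UpperHalfPlane) (α : ℝ) : SpecialLinearGroup (Fin 2) ℝ :=
  ⟨!![Real.cos α - Real.sin α * (p.re / p.im), Real.sin α * ((p.re ^ 2 + p.im ^ 2) / p.im);
      -(Real.sin α * (1 / p.im)), Real.cos α + Real.sin α * (p.re / p.im)], by
    have hv := p.im_ne_zero
    rw [det_fin_two_of]
    field_simp
    linear_combination p.im ^ 2 * Real.sin_sq_add_cos_sq α⟩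

theorem rotationMatrix_mul (p : UpperHalfPlane) (α β : ℝ) :
    rotationMatrix p α * rotationMatrix p β = rotationMatrix p (α + β) := by
  have hv := p.im_ne_zero
  refine Subtype.ext ((Matrix.SpecialLinearGroup.coe_mul _ _).trans ?_)
  simp only [rotationMatrix, mul_fin_two, Real.cos_add, Real.sin_add]
  ext i j
  fin_cases i <;> fin_cases j <;> simp <;> field_simp <;> ring

theorem rotationMatrix_zero (p : UpperHalfPlane) : rotationMatrix p 0 = 1 := by
  apply Subtype.ext
  simp [rotationMatrix, one_fin_two]

theorem rotationMatrix_pi (p : UpperHalfPlane) : rotationMatrix p Real.pi = -1 := by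
  apply Subtype.ext
  simp [rotationMatrix, one_fin_two]

theorem rotationMatrix_inv (p : UpperHalfPlane) (α : ℝ) :
    (rotationMatrix p α)⁻¹ = rotationMatrix p (-α) := by
  rw [inv_eq_iff_mul_eq_one, rotationMatrix_mul, add_neg_cancel, rotationMatrix_zero]

theorem rotationMatrix_pow (p : UpperHalfPlane) (α : ℝ) (n : ℕ) :
    rotationMatrix p α ^ n = rotationMatrix p (n * α) := by
  induction n with
  | zero => simp [rotationMatrix_zero]
  | succ n ih => rw [pow_succ, ih, rotationMatrix_mul]; push_cast; ring_nf

theorem isElliptic_rotationMatrix (p : UpperHalfPlane) {α : ℝ} (h : Real.sin α ≠ 0) :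
    (rotationMatrix p α).1.IsElliptic := by
  have ht : (rotationMatrix p α).1.trace = 2 * Real.cos α := by
    simp [rotationMatrix, trace_fin_two]
    ring
  rw [IsElliptic, discr_fin_two, (rotationMatrix p α).2, ht]
  have := Real.sin_sq_add_cos_sq α
  have : 0 < Real.sin α ^ 2 := by positivity
  linarith

theorem mk_neg_one : (QuotientGroup.mk (-1 : SpecialLinearGroup (Fin 2) ℝ) : PSL2R) = 1 := by
  rw [QuotientGroup.eq_one_iff, Subgroup.mem_center_iff]
  intro g
  simp

theorem mk_rotationMatrix_pow (p : UpperHalfPlane) {k : ℕ} (hk : k ≠ 0) :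
    (QuotientGroup.mk (rotationMatrix p (Real.pi / k)) : PSL2R) ^ k = 1 := by
  have hk' : (k : ℝ) ≠ 0 := Nat.cast_ne_zero.2 hk
  rw [← QuotientGroup.mk_pow, rotationMatrix_pow, mul_div_cancel₀ _ hk', rotationMatrix_pi,
    mk_neg_one]

theorem sub_conj_ne_zero (p z : UpperHalfPlane) :
    (z : ℂ) - (starRingEnd ℂ) (p : ℂ) ≠ 0 := by
  intro h
  have h1 := congrArg Complex.im h
  simp at h1
  linarith [p.im_pos, z.im_pos]

theorem discCoord_injective (p : UpperHalfPlane) : Function.Injective (discCoord p) := by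
  intro z w h
  unfold discCoord at h
  rw [div_eq_div_iff (sub_conj_ne_zero p z) (sub_conj_ne_zero p w)] at h
  have hp : (p : ℂ) - (starRingEnd ℂ) (p : ℂ) ≠ 0 := sub_conj_ne_zero p p
  apply UpperHalfPlane.ext
  rw [← sub_eq_zero]
  refine (mul_eq_zero.1 ?_).resolve_right hp
  linear_combination h

theorem discCoord_rotationMatrix_smul (p z : UpperHalfPlane) (α : ℝ) :
    discCoord p (rotationMatrix p α • z) =
      Complex.exp (2 * α * Complex.I) * discCoord p z := by
  have hv : (p.im : ℂ) ≠ 0 := Complex.ofReal_ne_zero.2 p.im_ne_zero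
  have hz := sub_conj_ne_zero p z
  have hz' := sub_conj_ne_zero p (rotationMatrix p α • z)
  have hcoe : ((rotationMatrix p α • z : UpperHalfPlane) : ℂ) =
      ((rotationMatrix p α).1 0 0 * z + (rotationMatrix p α).1 0 1) /
        ((rotationMatrix p α).1 1 0 * z + (rotationMatrix p α).1 1 1) := by
    rw [UpperHalfPlane.specialLinearGroup_apply]
    rfl
  have hden : ((rotationMatrix p α).1 1 0 * z + (rotationMatrix p α).1 1 1 : ℂ) ≠ 0 :=
    UpperHalfPlane.denom_ne_zero (rotationMatrix p α : GL (Fin 2) ℝ) z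
  have hp : (p : ℂ) = p.re + p.im * Complex.I := (Complex.re_add_im (p : ℂ)).symm
  have hpc : (starRingEnd ℂ) (p : ℂ) = p.re - p.im * Complex.I := by
    rw [hp]; simp [sub_eq_add_neg]
  -- `(p, 1)` and `(p̄, 1)` are eigenvectors of the matrix, for the eigenvalues `exp (∓ i α)`
  have e1 : ((rotationMatrix p α).1 0 0 * z + (rotationMatrix p α).1 0 1 : ℂ) -
      p * ((rotationMatrix p α).1 1 0 * z + (rotationMatrix p α).1 1 1) =
      Complex.exp (α * Complex.I) * (z - p) := by
    rw [Complex.exp_mul_I, hp]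
    simp [rotationMatrix]
    field_simp
    ring_nf
    simp only [Complex.I_sq]
    ring
  have e2 : ((rotationMatrix p α).1 0 0 * z + (rotationMatrix p α).1 0 1 : ℂ) -
      (starRingEnd ℂ) (p : ℂ) * ((rotationMatrix p α).1 1 0 * z + (rotationMatrix p α).1 1 1) =
      Complex.exp (-α * Complex.I) * (z - (starRingEnd ℂ) (p : ℂ)) := by
    rw [Complex.exp_mul_I, Complex.cos_neg, Complex.sin_neg, hpc]
    simp [rotationMatrix]
    field_simp
    ring_nf
    simp only [Complex.I_sq]
    ring
  have e3 : Complex.exp (2 * α * Complex.I) * Complex.exp (-α * Complex.I) =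
      Complex.exp (α * Complex.I) := by
    rw [← Complex.exp_add]; ring_nf
  unfold discCoord
  rw [hcoe] at hz' ⊢
  rw [← mul_div_assoc, div_eq_div_iff hz' hz, div_sub' hden, div_sub' hden]
  rw [mul_comm _ (p : ℂ), mul_comm _ ((starRingEnd ℂ) (p : ℂ)), e1, e2, ← e3]
  ring

/-- The action of `PSL₂(ℝ)` on the hyperbolic plane is faithful. -/
theorem mk_eq_mk_of_smul_eq {A B : SpecialLinearGroup (Fin 2) ℝ}
    (h : ∀ z : UpperHalfPlane, A • z = B • z) :
    (QuotientGroup.mk A : PSL2R) = QuotientGroup.mk B := by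
  rw [QuotientGroup.eq]
  have h' : ∀ z : UpperHalfPlane, (A⁻¹ * B) • z = z := fun z => by
    rw [mul_smul, ← h, inv_smul_smul]
  generalize A⁻¹ * B = M at h'
  have hM : ∀ y : ℝ, 0 < y → M.1 0 1 = -(M.1 1 0 * y ^ 2) ∧ M.1 0 0 = M.1 1 1 := by
    intro y hy
    have h1 := h' ⟨y * Complex.I, by simpa using hy⟩
    have h2 := congrArg UpperHalfPlane.coe h1
    rw [UpperHalfPlane.specialLinearGroup_apply] at h2
    have hden : ((M.1 1 0 : ℂ) * (y * Complex.I) + M.1 1 1) ≠ 0 :=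
      UpperHalfPlane.denom_ne_zero (M : GL (Fin 2) ℝ) ⟨y * Complex.I, by simpa using hy⟩
    change ((M.1 0 0 : ℂ) * (y * Complex.I) + M.1 0 1) /
      ((M.1 1 0 : ℂ) * (y * Complex.I) + M.1 1 1) = y * Complex.I at h2
    rw [div_eq_iff hden] at h2
    have h3 := congrArg Complex.re h2
    have h4 := congrArg Complex.im h2
    simp at h3 h4
    exact ⟨by linarith, mul_right_cancel₀ hy.ne' (by linarith)⟩
  obtain ⟨h1, h2⟩ := hM 1 one_pos
  obtain ⟨h3, -⟩ := hM 2 two_pos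
  have hc : M.1 1 0 = 0 := by linarith
  have hb : M.1 0 1 = 0 := by rw [h1, hc]; simp
  have hd := M.2
  rw [det_fin_two, hb, h2] at hd
  rw [Matrix.SpecialLinearGroup.mem_center_iff]
  refine ⟨M.1 1 1, by simp only [Fintype.card_fin]; linarith, ?_⟩
  ext i j
  fin_cases i <;> fin_cases j <;> simp [hc, hb, h2]

theorem isRotation_iff {g : PSL2R} {p : UpperHalfPlane} {α : ℝ} :
    IsRotation g p (2 * α) ↔ g = QuotientGroup.mk (rotationMatrix p α) := by
  constructor
  · rintro ⟨A, rfl, hA⟩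
    refine mk_eq_mk_of_smul_eq fun z => discCoord_injective p ?_
    rw [hA, discCoord_rotationMatrix_smul]
    push_cast
    rfl
  · rintro rfl
    refine ⟨_, rfl, fun z => ?_⟩
    rw [discCoord_rotationMatrix_smul]
    push_cast
    rfl

end

/-! ### Hyperbolic triangles and the product of the three rotations -/

noncomputable section
open Matrix

/-- The hyperbolic cosine of the hyperbolic distance. -/
def coshDist (p q : UpperHalfPlane) : ℝ :=
  ((p.re - q.re) ^ 2 + p.im ^ 2 + q.im ^ 2) / (2 * p.im * q.im)

/-- The vector in the direction of `discCoord p q` whose length is the hyperbolic sine of the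
distance from `p` to `q`. -/
def sinhVec (p q : UpperHalfPlane) : ℂ :=
  ⟨((q.re - p.re) ^ 2 + q.im ^ 2 - p.im ^ 2) / (2 * p.im * q.im), (p.re - q.re) / q.im⟩

/-- The oriented area of the parallelogram spanned by `sinhVec p q` and `sinhVec p r`. -/
def orientedArea (p q r : UpperHalfPlane) : ℝ :=
  (sinhVec p q).re * (sinhVec p r).im - (sinhVec p q).im * (sinhVec p r).re

theorem coshDist_comm (p q : UpperHalfPlane) : coshDist p q = coshDist q p := by
  unfold coshDist
  congr 1 <;> ring

theorem discCoord_eq_smul_sinhVec (p q : UpperHalfPlane) :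
    ∃ k : ℝ, 0 < k ∧ discCoord p q = k • sinhVec p q := by
  have hp := p.im_pos
  have hq := q.im_pos
  have hB : 0 < coshDist p q + 1 := by
    have : 0 ≤ coshDist p q := by unfold coshDist; positivity
    linarith
  refine ⟨(coshDist p q + 1)⁻¹, by positivity, ?_⟩
  rw [eq_inv_smul_iff₀ hB.ne', discCoord, ← smul_div_assoc, div_eq_iff (sub_conj_ne_zero p q)]
  apply Complex.ext
  · simp [sinhVec]
    unfold coshDist
    field_simp
    ring
  · simp [sinhVec]
    unfold coshDist
    field_simp
    ring

theorem norm_sinhVec_sq (p q : UpperHalfPlane) : ‖sinhVec p q‖ ^ 2 = coshDist p q ^ 2 - 1 := by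
  have hp := p.im_ne_zero
  have hq := q.im_ne_zero
  rw [Complex.sq_norm, Complex.normSq_apply, sinhVec, coshDist]
  field_simp
  ring

theorem norm_sinhVec_comm (p q : UpperHalfPlane) : ‖sinhVec p q‖ = ‖sinhVec q p‖ := by
  rw [← sq_eq_sq₀ (norm_nonneg _) (norm_nonneg _), norm_sinhVec_sq, norm_sinhVec_sq, coshDist_comm]

theorem norm_sinhVec_pos {p q : UpperHalfPlane} (h : p ≠ q) : 0 < ‖sinhVec p q‖ := by
  rw [norm_pos_iff]
  intro h0
  obtain ⟨k, -, hk⟩ := discCoord_eq_smul_sinhVec p q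
  apply h
  apply discCoord_injective p
  rw [hk, h0, smul_zero, discCoord, sub_self, zero_div]

theorem hyperbolicAngle_eq_angle_sinhVec (q p r : UpperHalfPlane) :
    hyperbolicAngle q p r = InnerProductGeometry.angle (sinhVec p q) (sinhVec p r) := by
  obtain ⟨k, hk, h⟩ := discCoord_eq_smul_sinhVec p q
  obtain ⟨k', hk', h'⟩ := discCoord_eq_smul_sinhVec p r
  rw [hyperbolicAngle, h, h', InnerProductGeometry.angle_smul_left_of_pos _ _ hk,
    InnerProductGeometry.angle_smul_right_of_pos _ _ hk']

theorem hyperbolicAngle_comm (q p r : UpperHalfPlane) :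
    hyperbolicAngle q p r = hyperbolicAngle r p q :=
  InnerProductGeometry.angle_comm _ _

theorem inner_sinhVec (p q r : UpperHalfPlane) :
    inner ℝ (sinhVec p q) (sinhVec p r) =
      coshDist p q * coshDist p r - coshDist q r := by
  have hp := p.im_ne_zero
  have hq := q.im_ne_zero
  have hr := r.im_ne_zero
  rw [Complex.inner]
  simp [sinhVec, coshDist]
  field_simp
  ring

/-- The hyperbolic law of cosines. -/
theorem cos_hyperbolicAngle (q p r : UpperHalfPlane) :
    Real.cos (hyperbolicAngle q p r) * (‖sinhVec p q‖ * ‖sinhVec p r‖) =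
      coshDist p q * coshDist p r - coshDist q r := by
  rw [hyperbolicAngle_eq_angle_sinhVec, InnerProductGeometry.cos_angle_mul_norm_mul_norm,
    inner_sinhVec]

theorem sin_hyperbolicAngle (q p r : UpperHalfPlane) :
    Real.sin (hyperbolicAngle q p r) * (‖sinhVec p q‖ * ‖sinhVec p r‖) =
      |orientedArea p q r| := by
  rw [hyperbolicAngle_eq_angle_sinhVec, InnerProductGeometry.sin_angle_mul_norm_mul_norm,
    ← Real.sqrt_sq_eq_abs]
  congr 1
  simp only [Complex.inner, orientedArea, Complex.mul_re, Complex.conj_re, Complex.conj_im]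
  ring

theorem orientedArea_rotate (p q r : UpperHalfPlane) :
    orientedArea q r p = orientedArea p q r := by
  have hp := p.im_ne_zero
  have hq := q.im_ne_zero
  have hr := r.im_ne_zero
  simp only [orientedArea, sinhVec]
  field_simp
  ring

/-- The matrix of trace zero and determinant one that fixes `p`. -/
def pointMatrix (p : UpperHalfPlane) : Matrix (Fin 2) (Fin 2) ℝ :=
  !![-(p.re / p.im), (p.re ^ 2 + p.im ^ 2) / p.im; -(1 / p.im), p.re / p.im]

/-- Half the commutator of the matrices of two points. Up to a scalar, it is the reflection in the
geodesic through the two points. -/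
def lineMatrix (p q : UpperHalfPlane) : Matrix (Fin 2) (Fin 2) ℝ :=
  (1 / 2 : ℝ) • (pointMatrix p * pointMatrix q - pointMatrix q * pointMatrix p)

theorem coe_rotationMatrix (p : UpperHalfPlane) (α : ℝ) :
    (rotationMatrix p α).1 = Real.cos α • 1 + Real.sin α • pointMatrix p := by
  ext i j
  fin_cases i <;> fin_cases j <;> simp [rotationMatrix, pointMatrix, sub_eq_add_neg]

theorem lineMatrix_swap (p q : UpperHalfPlane) : lineMatrix q p = -lineMatrix p q := by
  rw [lineMatrix, lineMatrix, ← smul_neg, neg_sub]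

theorem lineMatrix_mul_self (p q : UpperHalfPlane) :
    lineMatrix p q * lineMatrix p q = (‖sinhVec p q‖ ^ 2) • (1 : Matrix (Fin 2) (Fin 2) ℝ) := by
  have hp := p.im_ne_zero
  have hq := q.im_ne_zero
  rw [norm_sinhVec_sq]
  ext i j
  fin_cases i <;> fin_cases j <;>
    simp [lineMatrix, pointMatrix, coshDist, mul_apply, Fin.sum_univ_two] <;> field_simp <;> ring

/-- The product of the reflections in two geodesics through `p` is a rotation about `p`. -/
theorem lineMatrix_mul_lineMatrix (p q r : UpperHalfPlane) :
    lineMatrix p r * lineMatrix p q = (coshDist p q * coshDist p r - coshDist q r) • 1 +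
      orientedArea p q r • pointMatrix p := by
  have hp := p.im_ne_zero
  have hq := q.im_ne_zero
  have hr := r.im_ne_zero
  ext i j
  fin_cases i <;> fin_cases j <;>
    simp [lineMatrix, pointMatrix, coshDist, orientedArea, sinhVec, mul_apply,
      Fin.sum_univ_two] <;> field_simp <;> ring

theorem smul_rotationMatrix_eq {p q r : UpperHalfPlane} {α : ℝ}
    (hcos : Real.cos α = Real.cos (hyperbolicAngle q p r))
    (hsin : Real.sin α * (‖sinhVec p q‖ * ‖sinhVec p r‖) = orientedArea p q r) :
    (‖sinhVec p q‖ * ‖sinhVec p r‖) • (rotationMatrix p α).1 =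
      lineMatrix p r * lineMatrix p q := by
  rw [lineMatrix_mul_lineMatrix, ← cos_hyperbolicAngle, ← hsin, coe_rotationMatrix, smul_add,
    smul_smul, smul_smul, hcos, mul_comm, mul_comm (‖sinhVec p q‖ * _)]

/-- The product of the rotations about the vertices by twice the oriented angles is trivial, as each
rotation is the product of the reflections in two sides and the reflections cancel. -/
theorem rotationMatrix_mul_eq_neg_one {p q r : UpperHalfPlane} (hpq : p ≠ q) (hqr : q ≠ r)
    (hrp : r ≠ p) {α β γ : ℝ}
    (hcα : Real.cos α = Real.cos (hyperbolicAngle q p r))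
    (hsα : Real.sin α * (‖sinhVec p q‖ * ‖sinhVec p r‖) = orientedArea p q r)
    (hcβ : Real.cos β = Real.cos (hyperbolicAngle r q p))
    (hsβ : Real.sin β * (‖sinhVec q r‖ * ‖sinhVec q p‖) = orientedArea p q r)
    (hcγ : Real.cos γ = Real.cos (hyperbolicAngle p r q))
    (hsγ : Real.sin γ * (‖sinhVec r p‖ * ‖sinhVec r q‖) = orientedArea p q r) :
    rotationMatrix p α * rotationMatrix q β * rotationMatrix r γ = -1 := by
  have e1 := smul_rotationMatrix_eq hcα hsα
  have e2 := smul_rotationMatrix_eq hcβ (hsβ.trans (orientedArea_rotate p q r).symm)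
  have e3 := smul_rotationMatrix_eq hcγ
    (hsγ.trans ((orientedArea_rotate q r p).trans (orientedArea_rotate p q r)).symm)
  have h1 := norm_sinhVec_pos hpq
  have h2 := norm_sinhVec_pos hqr
  have h3 := norm_sinhVec_pos hrp
  rw [norm_sinhVec_comm p r, lineMatrix_swap r p] at e1
  rw [norm_sinhVec_comm q p, lineMatrix_swap p q] at e2
  rw [norm_sinhVec_comm r q, lineMatrix_swap q r] at e3
  have f1 := lineMatrix_mul_self p q
  have f2 := lineMatrix_mul_self q r
  have f3 := lineMatrix_mul_self r p
  generalize lineMatrix p q = X at *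
  generalize lineMatrix q r = Y at *
  generalize lineMatrix r p = Z at *
  generalize ‖sinhVec p q‖ = x at *
  generalize ‖sinhVec q r‖ = y at *
  generalize ‖sinhVec r p‖ = z at *
  apply Subtype.ext
  change (rotationMatrix p α).1 * (rotationMatrix q β).1 * (rotationMatrix r γ).1 = -1
  generalize (rotationMatrix p α).1 = E at *
  generalize (rotationMatrix q β).1 = F at *
  generalize (rotationMatrix r γ).1 = G at *
  have hne : x ^ 2 * y ^ 2 * z ^ 2 ≠ 0 := by positivity
  have key : (x ^ 2 * y ^ 2 * z ^ 2) • (E * F * G) = (x ^ 2 * y ^ 2 * z ^ 2) • (-1) := by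
    calc (x ^ 2 * y ^ 2 * z ^ 2) • (E * F * G)
        = ((x * z) • E) * ((y * x) • F) * ((z * y) • G) := by
          simp only [smul_mul_assoc, mul_smul_comm, smul_smul]
          congr 1
          ring
      _ = -(Z * (X * X) * (Y * Y) * Z) := by
          rw [e1, e2, e3]
          noncomm_ring
      _ = _ := by
          rw [f1, f2]
          simp only [smul_mul_assoc, mul_smul_comm, mul_one, f3, smul_smul, smul_neg]
          congr 2
          ring
  exact smul_right_injective _ hne key

/-- The generators of a triangle group are determined by the triangle, and their product, in one of
the two cyclic orders according to the orientation of the triangle, is trivial. -/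
theorem IsTriangleGroup.exists_generators {k l m : ℕ} (hk : 2 ≤ k) (hl : 2 ≤ l) (hm : 2 ≤ m)
    {Δ : Subgroup PSL2R} (h : IsTriangleGroup k l m Δ) :
    ∃ A B C : SpecialLinearGroup (Fin 2) ℝ,
      A.1.IsElliptic ∧ B.1.IsElliptic ∧ C.1.IsElliptic ∧
      ∃ a b c : PSL2R, QuotientGroup.mk A = a ∧ QuotientGroup.mk B = b ∧ QuotientGroup.mk C = c ∧
        a ^ k = 1 ∧ b ^ l = 1 ∧ c ^ m = 1 ∧ (a * b * c = 1 ∨ c * b * a = 1) ∧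
        Δ = Subgroup.closure {a, b, c} := by
  obtain ⟨p, q, r, hpq, hqr, hrp, hα, hβ, hγ, rfl⟩ := h
  have hsin : ∀ n : ℕ, 2 ≤ n → 0 < Real.sin (Real.pi / n) := fun n hn => by
    have hn' : (2 : ℝ) ≤ n := by exact_mod_cast hn
    refine Real.sin_pos_of_pos_of_lt_pi (by positivity) ?_
    rw [div_lt_iff₀ (by linarith)]
    nlinarith [Real.pi_pos]
  refine ⟨rotationMatrix p (Real.pi / k), rotationMatrix q (Real.pi / l),
    rotationMatrix r (Real.pi / m), isElliptic_rotationMatrix p (hsin k hk).ne',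
    isElliptic_rotationMatrix q (hsin l hl).ne', isElliptic_rotationMatrix r (hsin m hm).ne',
    _, _, _, rfl, rfl, rfl, mk_rotationMatrix_pow p (by omega), mk_rotationMatrix_pow q (by omega),
    mk_rotationMatrix_pow r (by omega), ?_, ?_⟩
  · rw [hyperbolicAngle_comm] at hα hβ hγ
    have sα := sin_hyperbolicAngle q p r
    have sβ := sin_hyperbolicAngle r q p
    have sγ := sin_hyperbolicAngle p r q
    rw [orientedArea_rotate] at sβ
    rw [orientedArea_rotate, orientedArea_rotate] at sγ
    rcases le_or_gt 0 (orientedArea p q r) with hpos | hneg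
    · rw [abs_of_nonneg hpos] at sα sβ sγ
      left
      rw [← hα, ← hβ, ← hγ, ← QuotientGroup.mk_mul, ← QuotientGroup.mk_mul,
        rotationMatrix_mul_eq_neg_one hpq hqr hrp rfl sα rfl sβ rfl sγ, mk_neg_one]
    · rw [abs_of_neg hneg] at sα sβ sγ
      right
      have h := rotationMatrix_mul_eq_neg_one hpq hqr hrp
        (Real.cos_neg (hyperbolicAngle q p r)) (by rw [Real.sin_neg]; linarith)
        (Real.cos_neg (hyperbolicAngle r q p)) (by rw [Real.sin_neg]; linarith)
        (Real.cos_neg (hyperbolicAngle p r q)) (by rw [Real.sin_neg]; linarith)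
      rw [← rotationMatrix_inv, ← rotationMatrix_inv, ← rotationMatrix_inv, hα, hβ, hγ] at h
      rw [← _root_.inv_inj, inv_one, ← mk_neg_one, ← h]
      simp only [_root_.mul_inv_rev, QuotientGroup.mk_mul, QuotientGroup.mk_inv, mul_assoc]
  · congr 1
    ext g
    simp only [Set.mem_ofPred_eq, Set.mem_insert_iff, Set.mem_singleton_iff, mul_div_assoc,
      isRotation_iff]

end

/-! ### Existence of the triangle and conclusion -/

noncomputable section

theorem hyperbolicAngle_eq_of_law_of_cosines {q p r : UpperHalfPlane} {θ x y : ℝ} (hθ : 0 ≤ θ)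
    (hθ' : θ ≤ Real.pi) (hx : 0 < x) (hy : 0 < y) (hpq : coshDist p q ^ 2 - 1 = x ^ 2)
    (hpr : coshDist p r ^ 2 - 1 = y ^ 2)
    (h : Real.cos θ * (x * y) = coshDist p q * coshDist p r - coshDist q r) :
    hyperbolicAngle q p r = θ := by
  have e1 : ‖sinhVec p q‖ = x := by
    rw [← sq_eq_sq₀ (norm_nonneg _) hx.le, norm_sinhVec_sq, hpq]
  have e2 : ‖sinhVec p r‖ = y := by
    rw [← sq_eq_sq₀ (norm_nonneg _) hy.le, norm_sinhVec_sq, hpr]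
  have hcos := cos_hyperbolicAngle q p r
  rw [e1, e2, ← h] at hcos
  have hmem : hyperbolicAngle q p r ∈ Set.Icc 0 Real.pi :=
    ⟨InnerProductGeometry.angle_nonneg _ _, InnerProductGeometry.angle_le_pi _ _⟩
  exact Real.injOn_cos hmem ⟨hθ, hθ'⟩ (mul_right_cancel₀ (mul_pos hx hy).ne' hcos)

/-- Existence of a hyperbolic triangle with angles `π/2`, `π/3`, `π/7`, with its right angle at `i`
and its legs on the imaginary axis and on the unit circle. -/
theorem exists_isTriangleGroup_two_three_seven : ∃ Δ : Subgroup PSL2R, IsTriangleGroup 2 3 7 Δ := by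
  have hπ := Real.pi_pos
  have hσ : 0 < Real.sin (Real.pi / 7) := Real.sin_pos_of_pos_of_lt_pi (by linarith) (by linarith)
  have hc : √3 / 2 < Real.cos (Real.pi / 7) := by
    rw [← Real.cos_pi_div_six]
    exact Real.cos_lt_cos_of_nonneg_of_le_pi (by linarith) (by linarith) (by linarith)
  have hcs := Real.sin_sq_add_cos_sq (Real.pi / 7)
  have h3 : √3 ^ 2 = 3 := Real.sq_sqrt (by norm_num)
  have h30 : 0 < √3 := Real.sqrt_pos.2 (by norm_num)
  have hcos3 := Real.cos_pi_div_three
  generalize Real.sin (Real.pi / 7) = σ at *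
  obtain ⟨c, hc7⟩ : ∃ c, Real.cos (Real.pi / 7) = c := ⟨_, rfl⟩
  rw [hc7] at hc hcs
  generalize √3 = d at *
  -- by the right-angled trigonometry, the leg `p q` has hyperbolic cosine `cos (π/7) / sin (π/3)`
  obtain ⟨C, hC⟩ : ∃ C, C = 2 * c / d := ⟨_, rfl⟩
  have hCd : C * d = 2 * c := by rw [hC]; field_simp
  have hC1 : 1 < C := by rw [hC, lt_div_iff₀ h30]; linarith
  obtain ⟨a, ha, haC⟩ : ∃ a, 0 < a ∧ C ^ 2 - 1 = a ^ 2 :=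
    ⟨√(C ^ 2 - 1), Real.sqrt_pos.2 (by nlinarith), (Real.sq_sqrt (by nlinarith)).symm⟩
  have hu : (d * a) ^ 2 + (2 * σ) ^ 2 = 1 := by
    rw [mul_pow, ← haC]
    linear_combination (C * d + 2 * c) * hCd - h3 + 4 * hcs
  -- `q` is at height `exp (d(p, q))`, with `C = cosh (d(p, q))` and `a = sinh (d(p, q))`, and the
  -- height of `r` on the unit circle is `1 / cosh (d(p, r)) = sin (π/7) / cos (π/3)`
  let p : UpperHalfPlane := ⟨⟨0, 1⟩, one_pos⟩
  let q : UpperHalfPlane := ⟨⟨0, C + a⟩, by change 0 < C + a; linarith⟩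
  let r : UpperHalfPlane := ⟨⟨d * a, 2 * σ⟩, by change 0 < 2 * σ; linarith⟩
  have hs0 : C + a ≠ 0 := by linarith
  have Bpq : coshDist p q = C := by
    change ((0 - 0) ^ 2 + 1 ^ 2 + (C + a) ^ 2) / (2 * 1 * (C + a)) = C
    field_simp
    linear_combination -haC
  have Bpr : coshDist p r = 1 / (2 * σ) := by
    change ((0 - d * a) ^ 2 + 1 ^ 2 + (2 * σ) ^ 2) / (2 * 1 * (2 * σ)) = 1 / (2 * σ)
    field_simp
    linear_combination hu
  have Bqr : coshDist q r = C / (2 * σ) := by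
    change ((0 - d * a) ^ 2 + (C + a) ^ 2 + (2 * σ) ^ 2) / (2 * (C + a) * (2 * σ)) = C / (2 * σ)
    field_simp
    linear_combination hu - haC
  have spq : coshDist p q ^ 2 - 1 = a ^ 2 := by rw [Bpq, haC]
  have spr : coshDist p r ^ 2 - 1 = (d * a / (2 * σ)) ^ 2 := by
    rw [Bpr]
    field_simp
    linear_combination -hu
  have sqr : coshDist q r ^ 2 - 1 = (2 * a / (2 * σ)) ^ 2 := by
    rw [Bqr]
    field_simp
    linear_combination haC - hu + a ^ 2 * h3
  have sqp := spq
  have srp := spr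
  have srq := sqr
  have Bqp := Bpq
  have Brp := Bpr
  have Brq := Bqr
  rw [coshDist_comm] at sqp srp srq Bqp Brp Brq
  refine ⟨_, p, q, r, fun h => ?_, fun h => ?_, fun h => ?_, ?_, ?_, ?_, rfl⟩
  · have h' : (1 : ℝ) = C + a := congrArg UpperHalfPlane.im h
    linarith
  · have h' : (0 : ℝ) = d * a := congrArg UpperHalfPlane.re h
    exact (mul_pos h30 ha).ne h'
  · have h' : d * a = (0 : ℝ) := congrArg UpperHalfPlane.re h
    exact (mul_pos h30 ha).ne' h'
  · refine hyperbolicAngle_eq_of_law_of_cosines (by positivity) (by push_cast; linarith)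
      (x := d * a / (2 * σ)) (y := a) (by positivity) ha spr spq ?_
    rw [Bpr, Bpq, Brq, Nat.cast_ofNat, Real.cos_pi_div_two]
    ring
  · refine hyperbolicAngle_eq_of_law_of_cosines (by positivity) (by push_cast; linarith)
      (x := a) (y := 2 * a / (2 * σ)) ha (by positivity) sqp sqr ?_
    rw [Bqp, Bqr, Bpr, Nat.cast_ofNat, hcos3]
    field_simp
    linear_combination -haC
  · refine hyperbolicAngle_eq_of_law_of_cosines (by positivity) (by push_cast; linarith)
      (x := 2 * a / (2 * σ)) (y := d * a / (2 * σ)) (by positivity) (by positivity) srq srp ?_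
    rw [Brq, Brp, Bqp, Nat.cast_ofNat, hc7]
    field_simp
    linear_combination C * hu - d * a ^ 2 * hCd

end

theorem mainTheorem6 :
    ¬ IsLocallyIndicable (QI (Set.Ici (0 : ℝ))) ∧
    (∃ Δ : Subgroup PSL2R, IsTriangleGroup 2 3 7 Δ) ∧
    ∀ Δ : Subgroup PSL2R, IsTriangleGroup 2 3 7 Δ →
      (∃ φ : liftToHomeo Δ →* QI (Set.Ici (0 : ℝ)), Function.Injective φ) ∧
      (liftToHomeo Δ).FG ∧
      ∀ χ : liftToHomeo Δ →* Multiplicative ℝ, χ = 1 := by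
  have main : ∀ Δ : Subgroup PSL2R, IsTriangleGroup 2 3 7 Δ →
      (∃ φ : liftToHomeo Δ →* QI (Set.Ici (0 : ℝ)), Function.Injective φ) ∧
      (liftToHomeo Δ).FG ∧
      ∀ χ : liftToHomeo Δ →* Multiplicative ℝ, χ = 1 := by
    intro Δ hΔ
    obtain ⟨A, B, C, hA, hB, hC, a, b, c, ha, hb, hc, ha2, hb3, hc7, habc, rfl⟩ :=
      hΔ.exists_generators le_rfl (by norm_num) (by norm_num)
    obtain ⟨hle, hfg, hχ⟩ := liftToHomeo_of_elliptic hA hB hC ha hb hc ha2 hb3 hc7 habc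
    exact ⟨⟨toQI.comp (Subgroup.inclusion hle),
      toQI_injective.comp (Subgroup.inclusion_injective hle)⟩, hfg, hχ⟩
  refine ⟨fun hind => ?_, exists_isTriangleGroup_two_three_seven, main⟩
  obtain ⟨Δ, hΔ⟩ := exists_isTriangleGroup_two_three_seven
  obtain ⟨⟨φ, hφ⟩, hfg, hχ⟩ := main Δ hΔ
  have : Group.FG (liftToHomeo Δ) := (Group.fg_iff_subgroup_fg _).2 hfg
  obtain ⟨ψ, hψ⟩ := hind φ.range ((Group.fg_iff_subgroup_fg _).1 inferInstance) fun hbot => by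
    have h1 : φ ⟨unitTranslation, 1, Δ.one_mem, covers_unitTranslation⟩ = 1 := by
      rw [← Subgroup.mem_bot, ← hbot]
      exact ⟨_, rfl⟩
    have h2 : unitTranslation = 1 := congrArg Subtype.val (hφ (h1.trans (map_one φ).symm))
    have h3 : (0 : ℝ) + 1 = 0 := congrArg (fun f : ℝ ≃ₜ ℝ => f 0) h2
    norm_num at h3
  obtain ⟨y, hy⟩ := hψ (Multiplicative.ofAdd 1)
  obtain ⟨x, rfl⟩ := φ.rangeRestrict_surjective y
  have h := DFunLike.congr_fun (hχ ((AddMonoidHom.toMultiplicative (Int.castAddHom ℝ)).comp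
    (ψ.comp φ.rangeRestrict))) x
  have h' := congrArg Multiplicative.toAdd h
  simp [hy] at h'
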